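/- Let $\mathfrak c$ be the cardinality of the continuum, and regard $\mathbb C^{\mathbb C}$, the set of all functions $\mathbb C\to\mathbb C$, as a commutative algebra over $\mathbb C$ with pointwise operations. For a cardinal $\kappa$, a set $E\subset\mathbb C^{\mathbb C}$ is called strongly $\kappa$-algebrable if $E\cup\{0\}$ contains a free subalgebra with $\kappa$ generators; that is, there is a set $X\subset\mathbb C^{\mathbb C}$ of cardinality $\kappa$ such that $P(x_1,\dots,x_n)\neq 0$ for every $n\ge 1$, all distinct $x_1,\dots,x_n\in X$ and every nonzero complex polynomial $P$ in $n$ variables without constant term, and such that the (not necessarily unital) subalgebra generated by $X$ is contained in $E\cup\{0\}$. A function $f:\mathbb C\to\mathbb C$ is strongly everywhere surjective if $|\{x\in U: f(x)=z\}|=\mathfrak c$ for every nonempty open $U\subset\mathbb C$ and every $z\in\mathbb C$. It has the Baire property if $f^{-1}(U)$ has the Baire property (differs from an open set by a meager set) for every open $U\subset\mathbb C$. It is Lebesgue measurable if the preimage of every Borel set is Lebesgue measurable. It is $s$-measurable if $f^{-1}(U)\in s(\mathbb C)$ for every open $U\subset\mathbb C$, where $s(\mathbb C)$ is the Marczewski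 $\sigma$-algebra of all $A\subset\mathbb C$ such that every nonempty perfect set $P\subset\mathbb C$ contains a nonempty perfect set $Q$ with $Q\subset A\cap P$ or $Q\subset P\setminus A$. Let $\mathcal G_1$ be the set of all strongly everywhere surjective functions $f:\mathbb C\to\mathbb C$ which have the Baire property but are neither Lebesgue measurable nor $s$-measurable. Let $\mathcal G_2$ be the set of all strongly everywhere surjective functions $f:\mathbb C\to\mathbb C$ which are Lebesgue measurable but neither have the Baire property nor are $s$-measurable. Theorem. Both $\mathcal G_1$ and $\mathcal G_2$ are strongly $2^{\mathfrak c}$-algebrable. -/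

import Mathlib

open Cardinal MeasureTheory Topology

/-- A set `X` in a commutative `K`-algebra `A` is a set of free generators (of the subalgebra,
not necessarily with unit, which it generates): no nonzero polynomial without constant term,
with variables from `X`, vanishes when its variables are replaced by the elements of `X`. -/
def IsFreeGeneratingSet (K : Type*) {A : Type*} [Field K] [CommRing A] [Algebra K A]
    (X : Set A) : Prop :=
  ∀ P : MvPolynomial X K, MvPolynomial.constantCoeff P = 0 → P ≠ 0 →
    MvPolynomial.aeval (fun x : X => (x : A)) P ≠ 0

/-- `E` is strongly `κ`-algebrable: `E ∪ {0}` contains a free (commutative, not necessarily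
unital) algebra with `κ` generators. -/
def StronglyAlgebrable (K : Type*) {A : Type*} [Field K] [CommRing A] [Algebra K A]
    (κ : Cardinal) (E : Set A) : Prop :=
  ∃ B : NonUnitalSubalgebra K A, (B : Set A) ⊆ E ∪ {0} ∧
    ∃ X : Set A, #X = κ ∧ IsFreeGeneratingSet K X ∧ NonUnitalAlgebra.adjoin K X = B

/-- `f` takes every value `𝔠` many times on every nonempty open set. -/
def StronglyEverywhereSurjective (f : ℂ → ℂ) : Prop :=
  ∀ U : Set ℂ, IsOpen U → U.Nonempty → ∀ z : ℂ, #{x : ℂ | x ∈ U ∧ f x = z} = 𝔠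

/-- The function `f` has the Baire property. -/
def HasBaireProperty {X Y : Type*} [TopologicalSpace X] [TopologicalSpace Y] (f : X → Y) : Prop :=
  ∀ U : Set Y, IsOpen U → BaireMeasurableSet (f ⁻¹' U)

/-- Membership of `A` in the Marczewski σ-algebra `s(X)`. -/
def MarczewskiSet {X : Type*} [TopologicalSpace X] (A : Set X) : Prop :=
  ∀ P : Set X, Perfect P → P.Nonempty →
    ∃ Q : Set X, Perfect Q ∧ Q.Nonempty ∧ Q ⊆ P ∧ (Q ⊆ A ∩ P ∨ Q ⊆ P \ A)

/-- The function `f` is `s(X)`-measurable. -/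
def SMeasurable {X Y : Type*} [TopologicalSpace X] [TopologicalSpace Y] (f : X → Y) : Prop :=
  ∀ U : Set Y, IsOpen U → MarczewskiSet (f ⁻¹' U)

/-- Strongly everywhere surjective functions with the Baire property that are neither Lebesgue
measurable nor `s`-measurable. `NullMeasurable f volume` says that preimages of Borel sets are
Lebesgue measurable, i.e. belong to the completion of the Borel σ-algebra. -/
def familyG₁ : Set (ℂ → ℂ) :=
  {f | StronglyEverywhereSurjective f ∧ HasBaireProperty f ∧
    ¬ NullMeasurable f volume ∧ ¬ SMeasurable f}

/-- Strongly everywhere surjective functions that are Lebesgue measurable and neither have the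
Baire property nor are `s`-measurable. -/
def familyG₂ : Set (ℂ → ℂ) :=
  {f | StronglyEverywhereSurjective f ∧ NullMeasurable f volume ∧
    ¬ HasBaireProperty f ∧ ¬ SMeasurable f}

/-! Split the plane into a comeager null Borel set `G` and its complement. A function vanishing off
`M` is almost everywhere zero if `M = G`, and zero on a comeager set if `M = Gᶜ`, so it is regular
in one sense. It is irregular in the other sense, and not `s`-measurable, once it takes every value
on each nonempty perfect subset of `M`, as Bernstein-type functions do. To get an algebra of these,
compose a map `b : ℂ → T` whose fibres meet every perfect set in `𝔠` points with `2 ^ 𝔠` independent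
functions on `T`. Finitely many generators then take any prescribed values together on each perfect
subset of `M`. A nonzero polynomial without constant term is onto `ℂ` and vanishes at the origin, so
its value at the generators is again such a function. -/

/-- An uncountable Borel subset of a Polish space contains a nonempty perfect set. -/
theorem MeasurableSet.exists_perfect_subset {α : Type*} [tα : TopologicalSpace α] [PolishSpace α]
    [MeasurableSpace α] [BorelSpace α] {s : Set α} (hs : MeasurableSet s) (hunc : ¬ s.Countable) :
    ∃ Q : Set α, Perfect Q ∧ Q.Nonempty ∧ Q ⊆ s := by
  -- A finer Polish topology makes `s` closed and yields a copy of the Cantor space in `s`. Its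
  -- image stays compact in the original coarser topology.
  obtain ⟨t, hle, ht, hclosed, -⟩ := hs.isClopenable
  obtain ⟨f, hfs, hf, hinj⟩ :=
    @IsClosed.exists_nat_bool_injection_of_not_countable α t ht s hclosed hunc
  have hf' : @Continuous _ α _ tα f := continuous_le_rng hle hf
  have hrange : ¬ (Set.range f).Countable := fun h => by
    have h1 : #(Set.range f) ≤ ℵ₀ := Cardinal.le_aleph0_iff_set_countable.2 h
    have h2 := Cardinal.mk_range_eq_of_injective hinj
    simp only [Cardinal.mk_pi, Cardinal.mk_bool, Cardinal.prod_const, Cardinal.lift_id] at h2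
    have h3 := Cardinal.lift_le_aleph0.2 h1
    rw [h2] at h3
    simp only [Cardinal.mk_eq_aleph0, Cardinal.two_power_aleph0, Cardinal.lift_continuum] at h3
    exact absurd h3 (not_le.2 Cardinal.aleph0_lt_continuum)
  obtain ⟨Q, hQ, hne, hsub⟩ := @exists_perfect_nonempty_of_isClosed_of_not_countable α tα _ _
    (@IsCompact.isClosed α tα _ _ (@isCompact_range _ _ _ tα _ _ hf')) hrange
  exact ⟨Q, hQ, hne, hsub.trans hfs⟩

theorem Perfect.continuum_le_mk {α : Type} [MetricSpace α] [CompleteSpace α] {Q : Set α}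
    (hQ : Perfect Q) (hne : Q.Nonempty) : 𝔠 ≤ #Q := by
  obtain ⟨f, hf, -, hinj⟩ := hQ.exists_nat_bool_injection hne
  have h := Cardinal.mk_le_of_injective (f := fun x => (⟨f x, hf ⟨x, rfl⟩⟩ : Q))
    fun x y hxy => hinj (congrArg Subtype.val hxy)
  simpa using h

/-- A family of at most `κ` sets of cardinality at least `κ` has an injective choice function. -/
theorem exists_injective_choice {ι α : Type} {κ : Cardinal} (hι : #ι ≤ κ) (S : ι → Set α)
    (hS : ∀ i, κ ≤ #(S i)) : ∃ x : ι → α, Function.Injective x ∧ ∀ i, x i ∈ S i := by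
  -- For a well-order of minimal type, proper initial segments have fewer than `#ι ≤ κ` elements, so
  -- recursion always finds an unused point of `S i`.
  obtain ⟨r, wo, hr⟩ := Cardinal.exists_ord_eq ι
  have key : ∀ (i : ι) (y : {j // r j i} → α), (S i \ Set.range y).Nonempty := by
    intro i y
    by_contra h
    rw [Set.not_nonempty_iff_eq_empty, Set.sdiff_eq_empty] at h
    have h1 : #(S i) ≤ #{j // r j i} := (Cardinal.mk_le_mk_of_subset h).trans Cardinal.mk_range_le
    have h2 : #{j // r j i} < #ι := by
      have := Cardinal.card_typein_lt i hr
      rwa [Ordinal.card_typein] at this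
    exact absurd ((hι.trans (hS i)).trans h1) (not_le.2 h2)
  let x : ι → α := wo.wf.fix fun i y => (key i fun j => y j.1 j.2).some
  have hx : ∀ i, x i ∈ S i \ Set.range fun j : {j // r j i} => x j := by
    intro i
    have : x i = (key i fun j => x j).some := wo.wf.fix_eq _ i
    rw [this]
    exact (key i fun j => x j).some_mem
  have hne : ∀ i j, r i j → x i ≠ x j := fun i j hij h => (hx j).2 ⟨⟨i, hij⟩, h⟩
  refine ⟨x, fun i j hij => ?_, fun i => (hx i).1⟩
  rcases trichotomous_of r i j with h | h | h
  · exact absurd hij (hne i j h)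
  · exact h
  · exact absurd hij.symm (hne j i h)

theorem mk_perfect_le_continuum : #{Q : Set ℂ // Perfect Q ∧ Q.Nonempty} ≤ 𝔠 := by
  have h := MeasurableSpace.cardinal_measurableSet_le_continuum
    (s := TopologicalSpace.countableBasis ℂ)
    ((TopologicalSpace.countable_countableBasis ℂ).le_aleph0.trans Cardinal.aleph0_le_continuum)
  rw [← (TopologicalSpace.isBasis_countableBasis ℂ).borel_eq_generateFrom] at h
  refine le_trans ?_ h
  refine Cardinal.mk_subtype_mono fun Q hQ => ?_
  have := hQ.1.closed.measurableSet
  rwa [BorelSpace.measurable_eq (α := ℂ)] at this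

/-- There is a map whose fibres meet every nonempty perfect set in continuum many points. -/
theorem exists_bernstein_map {T : Type} [Nonempty T] (hT : #T ≤ 𝔠) :
    ∃ b : ℂ → T, ∀ Q : Set ℂ, Perfect Q → Q.Nonempty → ∀ t, 𝔠 ≤ #{x | x ∈ Q ∧ b x = t} := by
  classical
  -- The factor `ℝ` yields continuum many distinct points for each pair of a perfect set and a
  -- value.
  have hcard : #({Q : Set ℂ // Perfect Q ∧ Q.Nonempty} × T × ℝ) ≤ 𝔠 := by
    simp only [Cardinal.mk_prod, Cardinal.lift_id, Cardinal.mk_real]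
    exact (mul_le_mul' mk_perfect_le_continuum (mul_le_mul' hT le_rfl)).trans (by simp)
  obtain ⟨x, hinj, hx⟩ := exists_injective_choice hcard (fun p => p.1.1)
    fun p => p.1.2.1.continuum_le_mk p.1.2.2
  refine ⟨Function.extend x (fun p => p.2.1) fun _ => Classical.arbitrary T,
    fun Q hQ hne t => ?_⟩
  have := Cardinal.mk_le_of_injective
    (f := fun r : ℝ => (⟨x (⟨Q, hQ, hne⟩, t, r), hx (⟨Q, hQ, hne⟩, t, r), hinj.extend_apply _ _ _⟩ :
      {y | y ∈ Q ∧ (Function.extend x (fun p => p.2.1) fun _ => Classical.arbitrary T) y = t}))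
    fun r r' h => by simpa using hinj (congrArg Subtype.val h)
  rwa [Cardinal.mk_real] at this

/-! ### Independent functions and polynomials -/

/-- There are `2 ^ 𝔠` functions on a set of size at most continuum which take arbitrary
prescribed values at any finite number of indices simultaneously. -/
theorem exists_independent_functions :
    ∃ (T : Type) (_ : Nonempty T) (h : Set ℂ → T → ℂ), #T ≤ 𝔠 ∧
      ∀ (F : Finset (Set ℂ)) (w : Set ℂ → ℂ), ∃ t, ∀ ξ ∈ F, h ξ t = w ξ := by
  classical
  -- An index is a finite set `A` with a table `c` of values on finite sets, and `ξ` reads off `c (A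
  -- ∩ ξ)`. Finite support keeps the index set of size at most `𝔠`.
  refine ⟨Finset ℂ × (Finset ℂ →₀ ℂ), inferInstance, fun ξ t => t.2 (t.1.filter (· ∈ ξ)),
    ?_, fun F w => ?_⟩
  · simp [Cardinal.mk_complex]
  · have hsep : ∀ p : Set ℂ × Set ℂ, ∃ x : ℂ, p.1 ≠ p.2 → ¬ (x ∈ p.1 ↔ x ∈ p.2) := by
      intro p
      by_cases hp : p.1 = p.2
      · exact ⟨0, fun h => absurd hp h⟩
      · by_contra! hcon
        exact hp (Set.ext fun x => (hcon x).2)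
    choose s hs using hsep
    -- One separating point for each pair in `F` makes the traces `A ∩ ξ` distinct, so values can be
    -- assigned to them freely.
    let A : Finset ℂ := (F ×ˢ F).image s
    have hinj : Set.InjOn (fun ξ : Set ℂ => A.filter (· ∈ ξ)) F := by
      intro ξ hξ η hη h
      by_contra hne
      refine hs (ξ, η) hne ?_
      have hmem : s (ξ, η) ∈ A := Finset.mem_image_of_mem _ (Finset.mk_mem_product hξ hη)
      have := congrArg (s (ξ, η) ∈ ·) h
      simpa [hmem] using this
    let φ : Finset ℂ → ℂ := fun B => w (Function.invFunOn (fun ξ : Set ℂ => A.filter (· ∈ ξ)) F B)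
    refine ⟨(A, Finsupp.onFinset (A.powerset) (fun B => if B ⊆ A then φ B else 0)
      fun B hB => ?_), fun ξ hξ => ?_⟩
    · simp only [ne_eq, ite_eq_right_iff, Classical.not_imp] at hB
      exact Finset.mem_powerset.2 hB.1
    · simp only [Finsupp.onFinset_apply, Finset.filter_subset, if_true]
      exact congrArg w (hinj.leftInvOn_invFunOn hξ)

/-- A nonzero polynomial without constant term over an algebraically closed field is surjective. -/
theorem MvPolynomial.exists_eval_eq {K σ : Type*} [Field K] [IsAlgClosed K]
    {P : MvPolynomial σ K} (h0 : MvPolynomial.constantCoeff P = 0) (hP : P ≠ 0) (z : K) :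
    ∃ w : σ → K, MvPolynomial.eval w P = z := by
  have : Infinite K := IsAlgClosed.instInfinite
  obtain ⟨a, ha⟩ : ∃ a, MvPolynomial.eval a P ≠ 0 := by
    by_contra! h
    exact hP (MvPolynomial.funext fun x => by simpa using h x)
  -- Restricted to the line through the origin and `a`, the polynomial is `0` at `0` and nonzero at
  -- `1`, hence nonconstant and onto.
  let q : Polynomial K := MvPolynomial.aeval (fun i => Polynomial.X * Polynomial.C (a i)) P
  have hq : ∀ t, q.eval t = MvPolynomial.eval (fun i => t * a i) P := by
    intro t
    have := MvPolynomial.map_aeval (fun i => Polynomial.X * Polynomial.C (a i))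
      (Polynomial.evalRingHom t) P
    simp only [Polynomial.coe_evalRingHom] at this
    rw [this]
    simp only [MvPolynomial.coe_eval₂Hom, MvPolynomial.eval, Polynomial.eval_mul,
      Polynomial.eval_X, Polynomial.eval_C]
    congr 1
    ext
    simp
  have hdeg : (q - Polynomial.C z).degree ≠ 0 := by
    intro hd
    obtain ⟨c, hc⟩ : ∃ c, q - Polynomial.C z = Polynomial.C c :=
      ⟨_, Polynomial.eq_C_of_degree_eq_zero hd⟩
    have e0 : q.eval 0 = 0 := by
      rw [hq]
      simp only [zero_mul]
      rw [MvPolynomial.eval_zero']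
      exact h0
    have e1 : q.eval 1 ≠ 0 := by simpa [hq] using ha
    have h0' := congrArg (Polynomial.eval 0) hc
    have h1' := congrArg (Polynomial.eval 1) hc
    simp only [Polynomial.eval_sub, Polynomial.eval_C] at h0' h1'
    apply e1
    rw [← e0]
    exact sub_left_injective (h1'.trans h0'.symm)
  obtain ⟨t, ht⟩ := IsAlgClosed.exists_root _ hdeg
  refine ⟨fun i => t * a i, ?_⟩
  rw [← hq]
  simpa [sub_eq_zero] using ht

/-! ### Measure and category as filters -/

/-- A countably complete filter with a basis of Borel sets, containing the complements of points
but no complement of a nonempty open set. -/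
structure IsBorelLargeFilter (l : Filter ℂ) : Prop where
  exists_measurable_subset : ∀ s ∈ l, ∃ t ⊆ s, MeasurableSet t ∧ t ∈ l
  compl_singleton_mem : ∀ x : ℂ, {x}ᶜ ∈ l
  compl_open_notMem : ∀ U : Set ℂ, IsOpen U → U.Nonempty → Uᶜ ∉ l

theorem IsBorelLargeFilter.compl_mem_of_countable {l : Filter ℂ} [CountableInterFilter l]
    (hl : IsBorelLargeFilter l) {s : Set ℂ} (hs : s.Countable) : sᶜ ∈ l := by
  rw [← Set.biUnion_of_singleton s, Set.compl_iUnion₂]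
  exact (countable_bInter_mem hs).2 fun x _ => hl.compl_singleton_mem x

theorem isBorelLargeFilter_ae : IsBorelLargeFilter (ae (volume : Measure ℂ)) where
  exists_measurable_subset s hs := by
    obtain ⟨t, hst, ht, h0⟩ := exists_measurable_superset_of_null (mem_ae_iff.1 hs)
    exact ⟨tᶜ, Set.compl_subset_comm.1 hst, ht.compl, by simpa [mem_ae_iff] using h0⟩
  compl_singleton_mem x := by simp [mem_ae_iff]
  compl_open_notMem U hU hne h := by
    rw [mem_ae_iff, compl_compl] at h
    exact (hU.measure_pos volume hne).ne' h

theorem isBorelLargeFilter_residual : IsBorelLargeFilter (residual ℂ) where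
  exists_measurable_subset s hs := by
    obtain ⟨t, hts, ht, hd⟩ := mem_residual.1 hs
    exact ⟨t, hts, ht.measurableSet, residual_of_dense_Gδ ht hd⟩
  compl_singleton_mem x := residual_of_dense_open isOpen_compl_singleton (dense_compl_singleton x)
  compl_open_notMem U hU hne h := not_isMeagre_of_isOpen hU hne h

/-- Intersect open neighbourhoods of a countable dense set whose measures tend to zero. -/
theorem exists_measurable_residual_null :
    ∃ G : Set ℂ, MeasurableSet G ∧ G ∈ residual ℂ ∧ volume G = 0 := by
  obtain ⟨D, hDc, hDd⟩ := TopologicalSpace.exists_countable_dense ℂ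
  have hU : ∀ n : ℕ, ∃ U ⊇ D, IsOpen U ∧ volume U < (n + 1 : ENNReal)⁻¹ := fun n =>
    D.exists_isOpen_lt_of_lt _ (by
      rw [hDc.measure_zero]
      exact ENNReal.inv_pos.2 (by finiteness))
  choose U hDU hUo hUlt using hU
  have hG : IsGδ (⋂ n, U n) := .iInter_of_isOpen hUo
  refine ⟨⋂ n, U n, hG.measurableSet, residual_of_dense_Gδ hG
    (hDd.mono (Set.subset_iInter hDU)), ?_⟩
  refine le_antisymm (ENNReal.le_of_forall_pos_le_add fun ε hε _ => ?_) zero_le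
  obtain ⟨n, hn⟩ := ENNReal.exists_inv_nat_lt (ENNReal.coe_pos.2 hε).ne'
  rw [zero_add]
  calc volume (⋂ n, U n) ≤ volume (U n) := measure_mono (Set.iInter_subset _ n)
    _ ≤ (n + 1 : ENNReal)⁻¹ := (hUlt n).le
    _ ≤ (n : ENNReal)⁻¹ := ENNReal.inv_le_inv.2 le_self_add
    _ ≤ ε := hn.le

/-! ### Perfectly surjective functions -/

/-- `f` vanishes off `M` and takes each value continuum many times on each nonempty perfect
subset of `M`. -/
structure IsPerfectlySurjectiveOn (M : Set ℂ) (f : ℂ → ℂ) : Prop where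
  eq_zero : ∀ x ∉ M, f x = 0
  continuum_le : ∀ Q : Set ℂ, Perfect Q → Q.Nonempty → Q ⊆ M → ∀ z, 𝔠 ≤ #{x | x ∈ Q ∧ f x = z}

namespace IsPerfectlySurjectiveOn

variable {M : Set ℂ} {f : ℂ → ℂ}

theorem exists_eq (hf : IsPerfectlySurjectiveOn M f) {Q : Set ℂ} (hQ : Perfect Q)
    (hne : Q.Nonempty) (hQM : Q ⊆ M) (z : ℂ) : ∃ x ∈ Q, f x = z := by
  have h := Cardinal.continuum_pos.trans_le (hf.continuum_le Q hQ hne hQM z)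
  obtain ⟨⟨x, hx⟩⟩ := Cardinal.mk_ne_zero_iff.1 h.ne'
  exact ⟨x, hx⟩

theorem countable_of_notMem_image (hf : IsPerfectlySurjectiveOn M f) {B : Set ℂ}
    (hB : MeasurableSet B) (hBM : B ⊆ M) {z : ℂ} (hz : ∀ x ∈ B, f x ≠ z) : B.Countable := by
  by_contra h
  obtain ⟨Q, hQ, hne, hQB⟩ := hB.exists_perfect_subset h
  obtain ⟨x, hx, rfl⟩ := hf.exists_eq hQ hne (hQB.trans hBM) z
  exact hz x (hQB hx) rfl

/-- If a Borel set `B` agreed with the preimage on a Borel `G ∈ l` inside `M`, then `f` would omit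
`0` on `G ∩ B` and `1` on `G \ B`. Both would contain no perfect set, so `G` would be countable,
which no member of `l` is. -/
theorem not_eventuallyMeasurableSet (hf : IsPerfectlySurjectiveOn M f) {l : Filter ℂ}
    [CountableInterFilter l] (hl : IsBorelLargeFilter l) (hM : M ∈ l) :
    ¬ ∃ B, MeasurableSet B ∧ f ⁻¹' {0}ᶜ =ᶠ[l] B := by
  rintro ⟨B, hB, hfB⟩
  obtain ⟨G, hG, hGm, hGl⟩ := hl.exists_measurable_subset _ (Filter.inter_mem hM hfB.mem_iff)
  have h1 : (G ∩ B).Countable :=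
    hf.countable_of_notMem_image (hGm.inter hB) (fun x hx => (hG hx.1).1) (z := 0)
      fun x hx => (hG hx.1).2.2 hx.2
  have h2 : (G \ B).Countable :=
    hf.countable_of_notMem_image (hGm.diff hB) (fun x hx => (hG hx.1).1) (z := 1)
      fun x hx h => hx.2 ((hG hx.1).2.1 (by simp [h]))
  have h3 := hl.compl_mem_of_countable (h1.union h2)
  rw [Set.inter_union_sdiff] at h3
  refine hl.compl_open_notMem _ isOpen_univ Set.univ_nonempty ?_
  simpa using Filter.inter_mem hGl h3

theorem exists_perfect_subset_inter {l : Filter ℂ} [CountableInterFilter l]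
    (hl : IsBorelLargeFilter l) (hMm : MeasurableSet M) (hM : M ∈ l) {U : Set ℂ} (hU : IsOpen U)
    (hne : U.Nonempty) : ∃ Q : Set ℂ, Perfect Q ∧ Q.Nonempty ∧ Q ⊆ M ∩ U := by
  refine (hMm.inter hU.measurableSet).exists_perfect_subset fun h => ?_
  refine hl.compl_open_notMem U hU hne ?_
  filter_upwards [hl.compl_mem_of_countable h, hM] with x hx hxM hxU using hx ⟨hxM, hxU⟩

theorem stronglyEverywhereSurjective (hf : IsPerfectlySurjectiveOn M f) {l : Filter ℂ}
    [CountableInterFilter l] (hl : IsBorelLargeFilter l) (hMm : MeasurableSet M) (hM : M ∈ l) :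
    StronglyEverywhereSurjective f := by
  intro U hU hne z
  obtain ⟨Q, hQ, hQne, hQM⟩ := exists_perfect_subset_inter hl hMm hM hU hne
  refine le_antisymm ((Cardinal.mk_set_le _).trans Cardinal.mk_complex.le) ?_
  refine (hf.continuum_le Q hQ hQne (fun x hx => (hQM hx).1) z).trans ?_
  exact Cardinal.mk_le_mk_of_subset fun x hx => ⟨(hQM hx.1).2, hx.2⟩

theorem not_sMeasurable (hf : IsPerfectlySurjectiveOn M f) {l : Filter ℂ}
    [CountableInterFilter l] (hl : IsBorelLargeFilter l) (hMm : MeasurableSet M) (hM : M ∈ l) :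
    ¬ SMeasurable f := by
  intro hs
  obtain ⟨P, hP, hPne, hPM⟩ :=
    exists_perfect_subset_inter hl hMm hM isOpen_univ Set.univ_nonempty
  obtain ⟨Q, hQ, hQne, hQP, hQ'⟩ := hs {0}ᶜ isOpen_compl_singleton P hP hPne
  have hQM : Q ⊆ M := fun x hx => (hPM (hQP hx)).1
  rcases hQ' with h | h
  · obtain ⟨x, hx, h0⟩ := hf.exists_eq hQ hQne hQM 0
    exact (h hx).1 h0
  · obtain ⟨x, hx, h1⟩ := hf.exists_eq hQ hQne hQM 1
    exact (h hx).2 (by simp [h1])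

theorem eventuallyEq_zero (hf : IsPerfectlySurjectiveOn M f) {l : Filter ℂ} (hM : Mᶜ ∈ l) :
    f =ᶠ[l] fun _ => 0 := by
  filter_upwards [hM] with x hx using hf.eq_zero x hx

theorem mem_familyG₁ (hf : IsPerfectlySurjectiveOn M f) (hMm : MeasurableSet M)
    (hM : M ∈ ae (volume : Measure ℂ)) (hM' : Mᶜ ∈ residual ℂ) : f ∈ familyG₁ := by
  refine ⟨hf.stronglyEverywhereSurjective isBorelLargeFilter_ae hMm hM, fun U hU => ?_,
    fun h => ?_, hf.not_sMeasurable isBorelLargeFilter_ae hMm hM⟩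
  · exact (MeasurableSet.baireMeasurableSet (measurable_const hU.measurableSet)).congr
      ((hf.eventuallyEq_zero hM').symm.preimage U)
  · exact hf.not_eventuallyMeasurableSet isBorelLargeFilter_ae hM
      (h isOpen_compl_singleton.measurableSet)

theorem mem_familyG₂ (hf : IsPerfectlySurjectiveOn M f) (hMm : MeasurableSet M)
    (hM : M ∈ residual ℂ) (hM' : Mᶜ ∈ ae (volume : Measure ℂ)) : f ∈ familyG₂ := by
  refine ⟨hf.stronglyEverywhereSurjective isBorelLargeFilter_residual hMm hM, ?_,
    fun h => ?_, hf.not_sMeasurable isBorelLargeFilter_residual hMm hM⟩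
  · exact (measurable_const.nullMeasurable).congr (hf.eventuallyEq_zero hM').symm
  · obtain ⟨B, hB, hfB⟩ := h {0}ᶜ isOpen_compl_singleton
    refine hf.not_eventuallyMeasurableSet isBorelLargeFilter_residual hM ⟨B, ?_, hfB⟩
    rw [BorelSpace.measurable_eq (α := ℂ)]
    exact hB

end IsPerfectlySurjectiveOn

/-! ### The free algebra -/

/-- There are `2 ^ 𝔠` functions vanishing off `M` such that any finitely many of them take
arbitrary prescribed values simultaneously at continuum many points of each nonempty perfect
subset of `M`. -/
theorem exists_independent_set {M : Set ℂ} (hM : ∃ Q : Set ℂ, Perfect Q ∧ Q.Nonempty ∧ Q ⊆ M) :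
    ∃ X : Set (ℂ → ℂ), #X = 2 ^ 𝔠 ∧ (∀ f ∈ X, ∀ x ∉ M, f x = 0) ∧
      ∀ Q : Set ℂ, Perfect Q → Q.Nonempty → Q ⊆ M → ∀ (F : Finset X) (w : X → ℂ),
        𝔠 ≤ #{x | x ∈ Q ∧ ∀ f ∈ F, f.1 x = w f} := by
  classical
  obtain ⟨T, hT, h, hTc, hh⟩ := exists_independent_functions
  obtain ⟨b, hb⟩ := exists_bernstein_map hTc
  let g : Set ℂ → ℂ → ℂ := fun ξ => M.indicator fun x => h ξ (b x)
  have hg : ∀ Q : Set ℂ, Perfect Q → Q.Nonempty → Q ⊆ M → ∀ (F : Finset (Set ℂ)) (w : Set ℂ → ℂ),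
      𝔠 ≤ #{x | x ∈ Q ∧ ∀ ξ ∈ F, g ξ x = w ξ} := by
    intro Q hQ hne hQM F w
    obtain ⟨t, ht⟩ := hh F w
    refine (hb Q hQ hne t).trans (Cardinal.mk_le_mk_of_subset ?_)
    rintro x ⟨hxQ, rfl⟩
    exact ⟨hxQ, fun ξ hξ => (Set.indicator_of_mem (hQM hxQ) _).trans (ht ξ hξ)⟩
  have hinj : Function.Injective g := by
    intro ξ η hξη
    by_contra hne
    obtain ⟨Q, hQ, hQne, hQM⟩ := hM
    have h1 := Cardinal.continuum_pos.trans_le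
      (hg Q hQ hQne hQM {ξ, η} fun ζ => if ζ = ξ then 0 else 1)
    obtain ⟨⟨x, -, hx⟩⟩ := Cardinal.mk_ne_zero_iff.1 h1.ne'
    have e1 := hx ξ (by simp)
    have e2 := hx η (by simp)
    rw [hξη] at e1
    simp [e1, Ne.symm hne] at e2
  refine ⟨Set.range g, ?_, ?_, fun Q hQ hne hQM F w => ?_⟩
  · rw [Cardinal.mk_range_eq _ hinj, Cardinal.mk_set, Cardinal.mk_complex]
  · rintro _ ⟨ξ, rfl⟩ x hx
    exact Set.indicator_of_notMem hx _
  · choose s hs using fun f : Set.range g => f.2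
    refine (hg Q hQ hne hQM (F.image s) fun ξ => w ⟨g ξ, ξ, rfl⟩).trans
      (Cardinal.mk_le_mk_of_subset ?_)
    rintro x ⟨hxQ, hx⟩
    refine ⟨hxQ, fun f hf => ?_⟩
    have := hx (s f) (Finset.mem_image_of_mem s hf)
    simpa only [hs] using this

theorem aeval_pi_apply {σ ι : Type*} (v : σ → ι → ℂ) (P : MvPolynomial σ ℂ) (x : ι) :
    MvPolynomial.aeval v P x = MvPolynomial.eval (fun i => v i x) P := by
  exact MvPolynomial.map_aeval v (Pi.evalRingHom (fun _ : ι => ℂ) x) P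

/-- Nonzero polynomials without constant term in independent functions are perfectly
surjective. -/
theorem isPerfectlySurjectiveOn_aeval {M : Set ℂ} {X : Set (ℂ → ℂ)}
    (h0 : ∀ f ∈ X, ∀ x ∉ M, f x = 0)
    (hX : ∀ Q : Set ℂ, Perfect Q → Q.Nonempty → Q ⊆ M → ∀ (F : Finset X) (w : X → ℂ),
      𝔠 ≤ #{x | x ∈ Q ∧ ∀ f ∈ F, f.1 x = w f})
    {P : MvPolynomial X ℂ} (hP0 : MvPolynomial.constantCoeff P = 0) (hP : P ≠ 0) :
    IsPerfectlySurjectiveOn M (MvPolynomial.aeval (fun f : X => (f : ℂ → ℂ)) P) where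
  eq_zero x hx := by
    rw [aeval_pi_apply]
    simp only [h0 _ (Subtype.prop _) x hx]
    rw [MvPolynomial.eval_zero']
    exact hP0
  continuum_le Q hQ hne hQM z := by
    obtain ⟨w, rfl⟩ := MvPolynomial.exists_eval_eq hP0 hP z
    -- Only the finitely many variables of `P` matter, so independence applies to the preimage `w`
    -- of `z`.
    refine (hX Q hQ hne hQM P.vars w).trans (Cardinal.mk_le_mk_of_subset ?_)
    rintro x ⟨hxQ, hx⟩
    refine ⟨hxQ, ?_⟩
    rw [aeval_pi_apply]
    exact MvPolynomial.eval₂Hom_congr' rfl (fun f hf _ => hx f hf) rfl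

theorem exists_aeval_of_mem_adjoin {K A : Type*} [Field K] [CommRing A] [Algebra K A] {X : Set A}
    {a : A} (ha : a ∈ NonUnitalAlgebra.adjoin K X) :
    ∃ P : MvPolynomial X K, MvPolynomial.constantCoeff P = 0 ∧
      MvPolynomial.aeval (fun x : X => (x : A)) P = a := by
  induction ha using NonUnitalAlgebra.adjoin_induction with
  | mem x hx => exact ⟨MvPolynomial.X ⟨x, hx⟩, by simp, by simp⟩
  | zero => exact ⟨0, by simp, by simp⟩
  | add x y _ _ hx hy =>
    obtain ⟨P, hP, rfl⟩ := hx
    obtain ⟨R, hR, rfl⟩ := hy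
    exact ⟨P + R, by simp [hP, hR], by simp⟩
  | mul x y _ _ hx hy =>
    obtain ⟨P, hP, rfl⟩ := hx
    obtain ⟨R, hR, rfl⟩ := hy
    exact ⟨P * R, by simp [hP], by simp⟩
  | smul r x _ hx =>
    obtain ⟨P, hP, rfl⟩ := hx
    exact ⟨r • P, by simp [hP], by simp⟩

theorem stronglyAlgebrable_of_isPerfectlySurjectiveOn {M : Set ℂ} {E : Set (ℂ → ℂ)}
    (hM : ∃ Q : Set ℂ, Perfect Q ∧ Q.Nonempty ∧ Q ⊆ M)
    (hE : ∀ f, IsPerfectlySurjectiveOn M f → f ∈ E) : StronglyAlgebrable ℂ (2 ^ 𝔠) E := by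
  obtain ⟨X, hX, h0, hind⟩ := exists_independent_set hM
  refine ⟨_, ?_, X, hX, fun P hP0 hP hzero => ?_, rfl⟩
  · intro a ha
    obtain ⟨P, hP0, rfl⟩ := exists_aeval_of_mem_adjoin ha
    by_cases hP : P = 0
    · right
      simp [hP]
    · exact Or.inl (hE _ (isPerfectlySurjectiveOn_aeval h0 hind hP0 hP))
  · obtain ⟨Q, hQ, hne, hQM⟩ := hM
    -- Freeness comes from the same surjectivity: the value `1` is attained, so the function is not
    -- zero.
    obtain ⟨x, -, hx⟩ := (isPerfectlySurjectiveOn_aeval h0 hind hP0 hP).exists_eq hQ hne hQM 1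
    simp [hzero] at hx

theorem mainTheorem9 :
    StronglyAlgebrable ℂ (2 ^ 𝔠) familyG₁ ∧ StronglyAlgebrable ℂ (2 ^ 𝔠) familyG₂ := by
  obtain ⟨G, hGm, hGr, hG0⟩ := exists_measurable_residual_null
  have hGae : Gᶜ ∈ ae (volume : Measure ℂ) := by simpa [mem_ae_iff] using hG0
  constructor
  · obtain ⟨Q, hQ, hne, hQM⟩ := IsPerfectlySurjectiveOn.exists_perfect_subset_inter
      isBorelLargeFilter_ae hGm.compl hGae isOpen_univ Set.univ_nonempty
    exact stronglyAlgebrable_of_isPerfectlySurjectiveOn ⟨Q, hQ, hne, fun x hx => (hQM hx).1⟩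
      fun f hf => hf.mem_familyG₁ hGm.compl hGae (by rwa [compl_compl])
  · obtain ⟨Q, hQ, hne, hQM⟩ := IsPerfectlySurjectiveOn.exists_perfect_subset_inter
      isBorelLargeFilter_residual hGm hGr isOpen_univ Set.univ_nonempty
    exact stronglyAlgebrable_of_isPerfectlySurjectiveOn ⟨Q, hQ, hne, fun x hx => (hQM hx).1⟩
      fun f hf => hf.mem_familyG₂ hGm hGr hGae
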